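/- Let $G$ be an uncountable Polish group and let $P(G)$ be the space of Borel probability measures on $G$, equipped with the weak (weak*) topology, i.e. the topology of convergence against bounded continuous functions. For a universally measurable set $A\subseteq G$ (one that is measurable with respect to the completion of every Borel probability measure on $G$; every analytic set is universally measurable) let $$T_l(A)=\{\mu\in P(G):\ \mu(gA)=0\ \text{ for all } g\in G\}.$$ The set $A$ is called left Haar-null if $T_l(A)\neq\varnothing$, and generically left Haar-null if $T_l(A)$ is co-meager in $P(G)$. Let $A\subseteq G$ be analytic. If $A$ is not generically left Haar-null, then the identity $1$ of $G$ lies in the interior of $$A^{-1}AA^{-1}A=\{a^{-1}bc^{-1}d:\ a,b,c,d\in A\}.$$ In particular, if $A$ is not left Haar-null, then $A$ is not generically left Haar-null, and hence $1\in\operatorname{int}(A^{-1}AA^{-1}A)$. -/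

import Mathlib

open scoped Pointwise

namespace SteinhausPolish

open MeasureTheory

/-- A subset of a topological space (with its Borel σ-algebra) is universally measurable if it is
measurable with respect to the completion of every Borel probability measure. -/
def UniversallyMeasurable {X : Type*} [MeasurableSpace X] (A : Set X) : Prop :=
  ∀ μ : ProbabilityMeasure X, NullMeasurableSet A (μ : Measure X)

/-- `T_l(A)`: the Borel probability measures on `G` vanishing on all left translates of `A`. -/
def leftNullMeasures {G : Type*} [Group G] [MeasurableSpace G] (A : Set G) :
    Set (ProbabilityMeasure G) :=
  {μ | ∀ g : G, (μ : Measure G) (g • A) = 0}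

/-- `A` is left Haar-null: it is universally measurable and `T_l(A)` is not empty. -/
def IsLeftHaarNull {G : Type*} [Group G] [MeasurableSpace G] (A : Set G) : Prop :=
  UniversallyMeasurable A ∧ ∃ μ : ProbabilityMeasure G, μ ∈ leftNullMeasures A

/-- `A` is generically left Haar-null: it is universally measurable and `T_l(A)` is co-meager in
the space of Borel probability measures on `G` with the topology of weak convergence. -/
def IsGenericallyLeftHaarNull {G : Type*} [Group G] [TopologicalSpace G] [MeasurableSpace G]
    [OpensMeasurableSpace G] (A : Set G) : Prop :=
  UniversallyMeasurable A ∧ leftNullMeasures A ∈ residual (ProbabilityMeasure G)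

end SteinhausPolish

/-! The dichotomy is whether `A⁻¹ * A` is meagre. If not, it is analytic, hence has the Baire
property, and Pettis' theorem applied to it gives the conclusion. If it is meagre, cover it by
countably many closed nowhere dense sets. Their preimages `D` under the open map `(x, y) ↦ x⁻¹ * y`
are closed with dense complement in `G × G`. A generic `μ` satisfies `(μ × μ) D = 0` for all of
them. By left invariance of `x⁻¹ * y` they cover every square `gA × gA`, so `μ (gA) ^ 2 = 0` for all
`g` at once. The generic statement holds because `(μ × μ) D < ε` is an open condition, and a dense
one: a finitely supported measure with small atoms can be perturbed until distinct atoms avoid `D`,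
leaving only the diagonal. For the last claim, `P(G)` is a nonempty Baire space, so a comeagre set
in it is nonempty. -/

open Set Filter Topology MeasureTheory Metric
open scoped ENNReal

/-! ### Analytic sets and the Baire property -/

/-- If every set has a measurable hull modulo the σ-filter `l`, then analytic sets are measurable
modulo `l`. -/
theorem MeasureTheory.AnalyticSet.eventuallyMeasurableSet {X : Type*} [TopologicalSpace X]
    [RegularSpace X] [T2Space X] [MeasurableSpace X] [OpensMeasurableSpace X]
    {l : Filter X} [CountableInterFilter l]
    (hull : ∀ B : Set X, ∃ M, EventuallyMeasurableSet ‹_› l M ∧ B ⊆ M ∧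
      ∀ N, EventuallyMeasurableSet ‹_› l N → B ⊆ N → M ≤ᶠ[l] N)
    {A : Set X} (hA : AnalyticSet A) : EventuallyMeasurableSet ‹_› l A := by
  rw [AnalyticSet] at hA
  rcases hA with rfl | ⟨f, hf, rfl⟩
  · exact MeasurableSet.empty.eventuallyMeasurableSet
  choose M hM hBM hMN using hull
  -- the image of the cylinder of sequences with prescribed initial segment
  let B : List ℕ → Set X := fun s => f '' {α | ∀ i : Fin s.length, α i = s.get i}
  -- The closure forces a branch of the sets `H s` to shrink to a single point, by continuity of
  -- `f`.
  let H : List ℕ → Set X := fun s => M (B s) ∩ closure (B s)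
  have hHm : ∀ s, EventuallyMeasurableSet ‹_› l (H s) := fun s =>
    MeasurableSet.inter (hM _) isClosed_closure.measurableSet.eventuallyMeasurableSet
  have hBH : ∀ s, B s ⊆ H s := fun s => subset_inter (hBM _) subset_closure
  have hBs : ∀ s, B s ⊆ ⋃ n, H (s ++ [n]) := by
    rintro s _ ⟨α, hα, rfl⟩
    refine mem_iUnion.2 ⟨α s.length, hBH _ ⟨α, fun i => ?_, rfl⟩⟩
    rcases i with ⟨i, hi⟩
    simp only [List.length_append, List.length_singleton] at hi
    rcases Nat.lt_succ_iff_lt_or_eq.1 hi with h | rfl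
    · simpa [List.getElem_append_left h] using hα ⟨i, h⟩
    · simp
  -- Minimality of the hull covers each `H s` by its children modulo `l`; as there are countably
  -- many `s`, one exceptional set suffices.
  have hstep : ∀ᶠ x in l, ∀ s, x ∈ H s → ∃ n, x ∈ H (s ++ [n]) := by
    refine eventually_countable_forall.2 fun s => ?_
    have := hMN (B s) (⋃ n, H (s ++ [n])) (MeasurableSet.iUnion fun n => hHm _) (hBs s)
    filter_upwards [this] with x hx hxs
    exact mem_iUnion.1 (hx hxs.1)
  have hroot : B [] = range f := by
    simp [B, ← image_univ]
  refine (hHm []).congr ?_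
  filter_upwards [hstep] with x hx
  refine propext ⟨fun h => hBH [] (hroot ▸ h), fun h => ?_⟩
  choose! n hn using hx
  -- follow the branch through `x`
  let S : ℕ → List ℕ := fun k => Nat.rec [] (fun _ s => s ++ [n s]) k
  have hS : ∀ k, S (k + 1) = S k ++ [n (S k)] := fun k => rfl
  have hSl : ∀ k, (S k).length = k := by
    intro k
    induction k with
    | zero => rfl
    | succ k ih => simp [hS, ih]
  have hSx : ∀ k, x ∈ H (S k) := by
    intro k
    induction k with
    | zero => exact h
    | succ k ih => exact hn _ ih
  let α : ℕ → ℕ := fun k => n (S k)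
  have hSα : ∀ k i (hi : i < (S k).length), (S k)[i] = α i := by
    intro k
    induction k with
    | zero => intro i hi; simp [S] at hi
    | succ k ih =>
      intro i hi
      have hi' : i < k + 1 := by simpa [hSl] using hi
      rcases Nat.lt_succ_iff_lt_or_eq.1 hi' with h | rfl
      · have h2 : i < (S k).length := by rwa [hSl]
        simp only [hS, List.getElem_append_left h2, ih i h2]
      · simp [hS, hSl, α]
  refine ⟨α, ?_⟩
  by_contra hne
  obtain ⟨U, hU, V, hV, hUV⟩ : ∃ U ∈ 𝓝 (f α), ∃ V ∈ 𝓝 x, Disjoint U V := by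
    have := disjoint_nhds_nhds.2 hne
    exact (Filter.disjoint_iff.1 this)
  have hpre : f ⁻¹' U ∈ 𝓝 α := hf.continuousAt hU
  rw [nhds_pi, Filter.mem_pi] at hpre
  obtain ⟨I, hI, t, ht, htU⟩ := hpre
  obtain ⟨k, hk⟩ := hI.bddAbove
  have hsub : B (S (k + 1)) ⊆ U := by
    rintro _ ⟨β, hβ, rfl⟩
    refine htU fun i hi => ?_
    have hik : i < (S (k + 1)).length := (hSl (k + 1)).symm ▸ Nat.lt_succ_of_le (hk hi)
    have : β i = α i := by
      have := hβ ⟨i, hik⟩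
      simpa [hSα (k + 1) i hik] using this
    rw [this]
    exact mem_of_mem_nhds (ht i)
  obtain ⟨y, hyV, hyB⟩ := mem_closure_iff_nhds.1 (hSx (k + 1)).2 V hV
  exact disjoint_left.1 hUV (hsub hyB) hyV

theorem MeasureTheory.AnalyticSet.nullMeasurableSet {X : Type*} [TopologicalSpace X]
    [RegularSpace X] [T2Space X] [MeasurableSpace X] [OpensMeasurableSpace X]
    {A : Set X} (hA : AnalyticSet A) (μ : Measure X) [IsFiniteMeasure μ] :
    NullMeasurableSet A μ := by
  refine hA.eventuallyMeasurableSet (l := ae μ) fun B => ⟨toMeasurable μ B,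
    (measurableSet_toMeasurable μ B).eventuallyMeasurableSet, subset_toMeasurable μ B,
    fun N hN hBN => ?_⟩
  have hN' : NullMeasurableSet N μ := hN
  have h1 : μ (toMeasurable μ B ∩ N) = μ (toMeasurable μ B) := by
    refine le_antisymm (measure_mono inter_subset_left) ?_
    rw [measure_toMeasurable]
    exact measure_mono (subset_inter (subset_toMeasurable μ B) hBN)
  have h2 : μ (toMeasurable μ B \ N) = 0 := by
    have := measure_inter_add_sdiff₀ (μ := μ) (toMeasurable μ B) hN'
    rw [h1] at this
    simpa using (ENNReal.add_right_inj (measure_ne_top μ _)).1 (this.trans (add_zero _).symm)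
  exact ae_le_set.2 h2

theorem MeasureTheory.AnalyticSet.baireMeasurableSet {X : Type*} [TopologicalSpace X]
    [RegularSpace X] [T2Space X] [SecondCountableTopology X]
    {A : Set X} (hA : AnalyticSet A) : BaireMeasurableSet A := by
  borelize X
  have key := hA.eventuallyMeasurableSet (l := residual X) fun B => ?_
  · obtain ⟨t, ht, hAt⟩ := key
    exact ht.baireMeasurableSet.congr hAt.symm
  let b := TopologicalSpace.countableBasis X
  -- `O` is the largest open set in which `B` is meagre, so `Oᶜ ∪ B` is a hull of `B`, equal to `Oᶜ`
  -- up to a meagre set.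
  let O : Set X := ⋃ U ∈ {U ∈ b | IsMeagre (U ∩ B)}, U
  have hO : IsOpen O := isOpen_biUnion fun U hU =>
    TopologicalSpace.isOpen_of_mem_countableBasis hU.1
  have hOB : IsMeagre (O ∩ B) := by
    simp only [O, iUnion_inter]
    exact isMeagre_biUnion ((TopologicalSpace.countable_countableBasis X).mono fun U hU => hU.1)
      fun U hU => hU.2
  refine ⟨Oᶜ ∪ B, ?_, subset_union_right, fun N hN hBN => ?_⟩
  · refine (hO.measurableSet.compl.eventuallyMeasurableSet (l := residual X)).congr ?_
    filter_upwards [hOB] with x hx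
    refine propext ⟨fun h => h.elim id fun h hxO => hx ⟨hxO, h⟩, Or.inl⟩
  · have hN' : BaireMeasurableSet N := by
      obtain ⟨t, ht, hNt⟩ := hN
      exact ht.baireMeasurableSet.congr hNt.symm
    obtain ⟨W, hW, hNW⟩ := hN'.compl.residualEq_isOpen
    have hWO : W ⊆ O := by
      intro x hx
      obtain ⟨U, hU, hxU, hUW⟩ :=
        (TopologicalSpace.isBasis_countableBasis X).exists_subset_of_mem_open hx hW
      refine mem_biUnion ⟨hU, ?_⟩ hxU
      have : (U ∩ B)ᶜ ∈ residual X := by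
        filter_upwards [hNW] with y hy hyUB
        exact (hy.mpr (hUW hyUB.1)) (hBN hyUB.2)
      exact this
    filter_upwards [hNW] with x hx hxM
    by_contra hxN
    have hxW : x ∈ W := hx.mp hxN
    exact hxM.elim (fun h => h (hWO hxW)) fun h => hxN (hBN h)

/-- **Pettis' theorem**: a non-meagre set with the Baire property in a Baire group satisfies
`1 ∈ interior (B⁻¹ * B)`. -/
theorem BaireMeasurableSet.one_mem_interior_inv_mul {G : Type*} [Group G] [TopologicalSpace G]
    [IsTopologicalGroup G] [BaireSpace G] {B : Set G} (hB : BaireMeasurableSet B)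
    (hB' : ¬ IsMeagre B) : (1 : G) ∈ interior (B⁻¹ * B) := by
  obtain ⟨U, hU, hBU⟩ := hB.residualEq_isOpen
  have hUne : U.Nonempty := by
    by_contra h
    rw [not_nonempty_iff_eq_empty] at h
    subst h
    refine hB' ?_
    show Bᶜ ∈ residual G
    filter_upwards [hBU] with x hx hxB
    exact hx.mp hxB
  obtain ⟨u, hu⟩ := hUne
  have hV : {g : G | u * g ∈ U} ∈ 𝓝 (1 : G) := by
    have : ContinuousAt (fun g : G => u * g) 1 := (continuous_const_mul u).continuousAt
    exact this (by simpa using hU.mem_nhds hu)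
  refine mem_interior_iff_mem_nhds.2 (Filter.mem_of_superset hV fun g hg => ?_)
  have hopen : IsOpen (U ∩ (fun x => x * g) ⁻¹' U) := hU.inter (hU.preimage (continuous_mul_const g))
  -- Modulo meagre sets this open set is `B ∩ B * g⁻¹`, which would be empty if `g ∉ B⁻¹ * B`.
  have hnm := not_isMeagre_of_isOpen hopen ⟨u, hu, hg⟩
  have hBg : ((fun x => x * g) ⁻¹' B : Set G) =ᶠ[residual G] ((fun x => x * g) ⁻¹' U : Set G) :=
    hBU.comp_tendsto
      (tendsto_residual_of_isOpenMap (continuous_mul_const g) (isOpenMap_mul_right g))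
  by_contra hg'
  refine hnm ?_
  show _ ∈ residual G
  filter_upwards [hBU, hBg] with x hx hxg hxU
  have h1 : x ∈ B := hx.mpr hxU.1
  have h2 : x * g ∈ B := hxg.mpr hxU.2
  exact hg' ⟨x⁻¹, inv_mem_inv.2 h1, x * g, h2, by group⟩

/-! ### The space of probability measures is Baire -/

theorem MeasureTheory.isTightMeasureSet_of_forall_exists_cthickening {X : Type*}
    [PseudoMetricSpace X] [CompleteSpace X] [MeasurableSpace X] {S : Set (Measure X)}
    (h : ∀ δ : ℝ, 0 < δ → ∀ ε : ℝ≥0∞, 0 < ε →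
      ∃ K : Set X, IsCompact K ∧ ∀ μ ∈ S, μ (cthickening δ K)ᶜ ≤ ε) :
    IsTightMeasureSet S := by
  rw [isTightMeasureSet_iff_exists_isCompact_measure_compl_le]
  intro ε hε
  obtain ⟨e, he, hesum⟩ := ENNReal.exists_pos_sum_of_countable' hε.ne' ℕ
  choose K hK hKS using fun n : ℕ => h (1 / (n + 1 : ℝ)) Nat.one_div_pos_of_nat (e n) (he n)
  refine ⟨⋂ n : ℕ, cthickening (1 / (n + 1 : ℝ)) (K n), ?_, fun μ hμ => ?_⟩
  · refine TotallyBounded.isCompact_of_isClosed ?_ (isClosed_iInter fun n => isClosed_cthickening)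
    refine totallyBounded_iff.2 fun δ hδ => ?_
    obtain ⟨n, hn⟩ := exists_nat_one_div_lt (half_pos hδ)
    obtain ⟨t, ht, htK⟩ := totallyBounded_iff.1 (hK n).totallyBounded (δ / 2) (half_pos hδ)
    refine ⟨t, ht, fun x hx => ?_⟩
    have hx' := mem_iInter.1 hx n
    have hx2 := cthickening_subset_thickening' (half_pos hδ) hn (K n) hx'
    obtain ⟨z, hz, hxz⟩ := mem_thickening_iff.1 hx2
    obtain ⟨y, hy, hzy⟩ := mem_iUnion₂.1 (htK hz)
    refine mem_iUnion₂.2 ⟨y, hy, ?_⟩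
    rw [mem_ball] at *
    linarith [dist_triangle x z y]
  · rw [compl_iInter]
    calc μ (⋃ n : ℕ, (cthickening (1 / (n + 1 : ℝ)) (K n))ᶜ)
        ≤ ∑' n : ℕ, μ (cthickening (1 / (n + 1 : ℝ)) (K n))ᶜ := measure_iUnion_le _
      _ ≤ ∑' n, e n := ENNReal.tsum_le_tsum fun n => hKS n μ hμ
      _ ≤ ε := hesum.le

/-- A Cauchy sequence is tight, so Prokhorov's theorem yields a convergent subsequence. For
tightness, finitely many terms share a compact `K`, and all later terms, being close to `v N`,
nearly live on a thickening of `K`. -/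
instance MeasureTheory.LevyProkhorov.instCompleteSpaceProbabilityMeasure {X : Type*}
    [MetricSpace X] [CompleteSpace X] [SecondCountableTopology X] [MeasurableSpace X]
    [BorelSpace X] : CompleteSpace (LevyProkhorov (ProbabilityMeasure X)) := by
  refine Metric.complete_of_cauchySeq_tendsto fun u hu => ?_
  let v : ℕ → ProbabilityMeasure X := fun n => (u n).toMeasure
  have htight : IsTightMeasureSet {((μ : ProbabilityMeasure X) : Measure X) | μ ∈ range v} := by
    refine isTightMeasureSet_of_forall_exists_cthickening fun δ hδ ε hε => ?_
    obtain ⟨r, hr0, hrδ, hrε⟩ : ∃ r : ℝ, 0 < r ∧ r ≤ δ ∧ ENNReal.ofReal r ≤ ε / 2 := by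
      by_cases htop : ε = ∞
      · exact ⟨δ, hδ, le_rfl, by simp [htop, ENNReal.top_div]⟩
      · have h2 : 0 < (ε / 2).toReal :=
          ENNReal.toReal_pos (ENNReal.half_pos hε.ne').ne' (by finiteness)
        refine ⟨min δ (ε / 2).toReal, lt_min hδ h2, min_le_left _ _, ?_⟩
        exact (ENNReal.ofReal_le_ofReal (min_le_right _ _)).trans ENNReal.ofReal_toReal_le
    obtain ⟨N, hN⟩ := Metric.cauchySeq_iff.1 hu r hr0
    have hfin : IsCompact (closure (v '' Iic N)) :=
      ((finite_Iic N).image v).isCompact.closure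
    obtain ⟨K, hK, hKv⟩ := isTightMeasureSet_iff_exists_isCompact_measure_compl_le.1
      (isTightMeasureSet_of_isCompact_closure hfin) (ε / 2) (ENNReal.half_pos hε.ne')
    refine ⟨K, hK, ?_⟩
    rintro _ ⟨_, ⟨n, rfl⟩, rfl⟩
    rcases le_total n N with hn | hn
    · calc (v n : Measure X) (cthickening δ K)ᶜ ≤ (v n : Measure X) Kᶜ :=
            measure_mono (compl_subset_compl.2 (self_subset_cthickening K))
        _ ≤ ε / 2 := hKv _ ⟨_, ⟨n, hn, rfl⟩, rfl⟩
        _ ≤ ε := ENNReal.half_le_self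
    · have hd : levyProkhorovEDist (v N : Measure X) (v n : Measure X) < ENNReal.ofReal r := by
        have := hN N le_rfl n hn
        rwa [← edist_lt_ofReal, LevyProkhorov.edist_probabilityMeasure_def] at this
      have h1 := left_measure_le_of_levyProkhorovEDist_lt hd hK.measurableSet
      rw [ENNReal.toReal_ofReal hr0.le] at h1
      have h2 : (v n : Measure X) (cthickening δ K)ᶜ ≤ (v n : Measure X) (thickening r K)ᶜ :=
        measure_mono (compl_subset_compl.2
          ((thickening_subset_cthickening r K).trans (cthickening_mono hrδ K)))
      refine h2.trans ?_
      have hNK : (v N : Measure X) Kᶜ ≤ ε / 2 := hKv _ ⟨_, ⟨N, self_mem_Iic, rfl⟩, rfl⟩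
      rw [prob_compl_eq_one_sub isOpen_thickening.measurableSet]
      refine tsub_le_iff_right.2 ?_
      calc (1 : ℝ≥0∞) = (v N : Measure X) Kᶜ + (v N : Measure X) K := by
            rw [add_comm, prob_add_prob_compl hK.measurableSet]
        _ ≤ ε / 2 + ((v n : Measure X) (thickening r K) + ε / 2) := by gcongr; exact h1.trans (by gcongr)
        _ = ε / 2 + ε / 2 + (v n : Measure X) (thickening r K) := by ring
        _ = _ := by rw [ENNReal.add_halves]
  have hc := isCompact_closure_of_isTightMeasureSet htight
  obtain ⟨μ, -, φ, hφ, hlim⟩ := hc.isSeqCompact fun n => subset_closure (mem_range_self n)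
  refine ⟨LevyProkhorov.ofMeasure μ, tendsto_nhds_of_cauchySeq_of_subseq hu hφ.tendsto_atTop ?_⟩
  exact (LevyProkhorov.continuous_ofMeasure_probabilityMeasure.tendsto μ).comp hlim

instance MeasureTheory.ProbabilityMeasure.instBaireSpace {X : Type*} [TopologicalSpace X]
    [PolishSpace X] [MeasurableSpace X] [BorelSpace X] : BaireSpace (ProbabilityMeasure X) := by
  let := TopologicalSpace.upgradeIsCompletelyMetrizable X
  exact (LevyProkhorov.probabilityMeasureHomeomorph (Ω := X)).symm.baireSpace

/-! ### Generic measures and nowhere dense sets in the square -/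

theorem isOpenMap_eval_pair {ι X : Type*} [DecidableEq ι] [TopologicalSpace X] {p q : ι}
    (hpq : p ≠ q) : IsOpenMap fun x : ι → X => (x p, x q) := by
  refine IsOpenMap.of_sections fun x =>
    ⟨fun y => Function.update (Function.update x p y.1) q y.2, ?_, ?_, fun y => ?_⟩
  · exact ((continuous_const.update p continuous_fst).update q continuous_snd).continuousAt
  · simp
  · simp [Function.update_of_ne hpq]

/-- In a power of `X`, the points all of whose pairs of distinct coordinates avoid a closed set
with dense complement are dense. -/
theorem dense_setOf_pairwise_notMem {ι X : Type*} [Finite ι] [TopologicalSpace X]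
    {D : Set (X × X)} (hD : IsClosed D) (hD' : Dense Dᶜ) :
    Dense {x : ι → X | ∀ p q, p ≠ q → (x p, x q) ∉ D} := by
  classical
  have hev : ∀ r : {r : ι × ι // r.1 ≠ r.2},
      Continuous fun x : ι → X => (x r.1.1, x r.1.2) := fun r => by fun_prop
  have hset : {x : ι → X | ∀ p q, p ≠ q → (x p, x q) ∉ D} =
      ⋂₀ range fun (r : {r : ι × ι // r.1 ≠ r.2}) =>
        (fun x : ι → X => (x r.1.1, x r.1.2)) ⁻¹' Dᶜ := by
    ext x
    simp
  rw [hset]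
  have hfin := finite_range fun (r : {r : ι × ι // r.1 ≠ r.2}) =>
    (fun x : ι → X => (x r.1.1, x r.1.2)) ⁻¹' Dᶜ
  refine hfin.dense_sInter ?_ ?_
  · rintro _ ⟨r, rfl⟩
    exact hD.isOpen_compl.preimage (hev r)
  · rintro _ ⟨r, rfl⟩
    exact hD'.preimage (isOpenMap_eval_pair r.2)

namespace MeasureTheory.ProbabilityMeasure

/-- The probability measure `∑ i, w i • δ_{x i}`. -/
noncomputable def discrete {ι X : Type*} [Fintype ι] [MeasurableSpace X] (w : ι → ℝ≥0∞)
    (hw : ∑ i, w i = 1) (x : ι → X) : ProbabilityMeasure X :=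
  ⟨∑ i, w i • Measure.dirac (x i), ⟨by simp [hw]⟩⟩

theorem continuous_discrete {ι X : Type*} [Fintype ι] [TopologicalSpace X] [MeasurableSpace X]
    [OpensMeasurableSpace X] (w : ι → ℝ≥0∞) (hw : ∑ i, w i = 1) :
    Continuous (discrete w hw : (ι → X) → ProbabilityMeasure X) := by
  refine continuous_iff_forall_continuous_lintegral.2 fun f => ?_
  have hf : Measurable fun x => (f x : ℝ≥0∞) := f.continuous.measurable.coe_nnreal_ennreal
  have hw' : ∀ i, w i ≠ ∞ := fun i => ne_top_of_le_ne_top ENNReal.one_ne_top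
    (hw ▸ Finset.single_le_sum (f := w) (fun _ _ => zero_le) (Finset.mem_univ i))
  simp only [discrete, coe_mk, lintegral_finsetSum_measure, lintegral_smul_measure,
    lintegral_dirac' _ hf, smul_eq_mul]
  refine continuous_finsetSum _ fun i _ => (ENNReal.continuous_const_mul (hw' i)).comp ?_
  exact ENNReal.continuous_coe.comp (f.continuous.comp (continuous_apply i))

/-- Only the index pairs `(p, p)` can contribute, with total at most `∑ p, w p ^ 2 ≤ c`. -/
theorem prod_discrete_le {ι X : Type*} [Fintype ι] [MeasurableSpace X]
    {w : ι → ℝ≥0∞} (hw : ∑ i, w i = 1) {c : ℝ≥0∞} (hc : ∀ i, w i ≤ c) {D : Set (X × X)}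
    (hD : MeasurableSet D) {x : ι → X} (hx : ∀ p q, p ≠ q → (x p, x q) ∉ D) :
    ((discrete w hw x).prod (discrete w hw x) : Measure (X × X)) D ≤ c := by
  have hm : Measurable fun a => (discrete w hw x : Measure X) (Prod.mk a ⁻¹' D) :=
    measurable_measure_prodMk_left hD
  rw [toMeasure_prod, Measure.prod_apply hD]
  have h1 : ∀ p, (discrete w hw x : Measure X) (Prod.mk (x p) ⁻¹' D) ≤ c := by
    intro p
    have hs : MeasurableSet (Prod.mk (x p) ⁻¹' D) := measurable_prodMk_left hD
    simp only [discrete, coe_mk, Measure.finsetSum_apply, Measure.smul_apply,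
      Measure.dirac_apply' _ hs, smul_eq_mul]
    rw [Finset.sum_eq_single p]
    · refine le_trans (mul_le_of_le_one_right' ?_) (hc p)
      exact indicator_le_self' (by simp) _
    · intro q _ hqp
      simp [hx p q hqp.symm]
    · simp
  calc ∫⁻ a, (discrete w hw x : Measure X) (Prod.mk a ⁻¹' D) ∂(discrete w hw x : Measure X)
      = ∑ p, w p * (discrete w hw x : Measure X) (Prod.mk (x p) ⁻¹' D) := by
        generalize hg : (fun a => (discrete w hw x : Measure X) (Prod.mk a ⁻¹' D)) = g at hm
        have hgx : ∀ a, (discrete w hw x : Measure X) (Prod.mk a ⁻¹' D) = g a := fun a => hg ▸ rfl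
        simp only [hgx]
        simp only [discrete, coe_mk, lintegral_finsetSum_measure, lintegral_smul_measure,
          smul_eq_mul, lintegral_dirac' _ hm]
    _ ≤ ∑ p, w p * c := by gcongr with p; exact h1 p
    _ = c := by rw [← Finset.sum_mul, hw, one_mul]

theorem exists_simpleFunc_map_mem {X : Type*} [TopologicalSpace X]
    [TopologicalSpace.PseudoMetrizableSpace X] [SecondCountableTopology X] [MeasurableSpace X]
    [BorelSpace X] {U : Set (ProbabilityMeasure X)} (hU : IsOpen U) {μ : ProbabilityMeasure X}
    (hμ : μ ∈ U) : ∃ f : SimpleFunc X X, μ.map f.measurable.aemeasurable ∈ U := by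
  let f : ℕ → SimpleFunc X X := (stronglyMeasurable_id (α := X)).approx
  have hf : ∀ x, Tendsto (fun n => f n x) atTop (𝓝 x) := stronglyMeasurable_id.tendsto_approx
  have hlim : Tendsto (fun n => μ.map (f n).measurable.aemeasurable) atTop (𝓝 μ) := by
    refine tendsto_iff_forall_integral_tendsto.2 fun g => ?_
    have h : ∀ n, ∫ x, g x ∂(μ.map (f n).measurable.aemeasurable : Measure X) =
        ∫ x, g (f n x) ∂(μ : Measure X) := fun n =>
      integral_map (f n).measurable.aemeasurable g.continuous.aestronglyMeasurable
    simp only [h]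
    refine tendsto_integral_of_dominated_convergence (fun _ => ‖g‖) (fun n => ?_)
      (integrable_const _) (fun n => .of_forall fun x => g.norm_coe_le_norm _)
      (.of_forall fun x => (g.continuous.tendsto x).comp (hf x))
    exact (g.continuous.measurable.comp (f n).measurable).aestronglyMeasurable
  obtain ⟨n, hn⟩ := (hlim.eventually (hU.mem_nhds hμ)).exists
  exact ⟨f n, hn⟩

/-- Each atom is split into `N` equal atoms at the same point, which bounds the weights and lets the
copies be moved apart later. -/
theorem exists_discrete_eq_map {X : Type*} [MeasurableSpace X] (μ : ProbabilityMeasure X)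
    (f : SimpleFunc X X) {N : ℕ} (hN : N ≠ 0) :
    ∃ (w : f.range × Fin N → ℝ≥0∞) (hw : ∑ i, w i = 1), (∀ i, w i ≤ (N : ℝ≥0∞)⁻¹) ∧
      discrete w hw (fun i => (i.1 : X)) = μ.map f.measurable.aemeasurable := by
  let w : f.range × Fin N → ℝ≥0∞ := fun i => (μ : Measure X) (f ⁻¹' {(i.1 : X)}) * (N : ℝ≥0∞)⁻¹
  have hmeas : (∑ i, w i • Measure.dirac (i.1 : X)) = (μ : Measure X).map f := by
    ext s hs
    have hfs : (μ : Measure X).map f s =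
        ∑ x ∈ f.range, s.indicator 1 x * (μ : Measure X) (f ⁻¹' {x}) := by
      rw [← SimpleFunc.map_lintegral, ← SimpleFunc.lintegral_eq_lintegral,
        ← lintegral_indicator_one hs, lintegral_map (measurable_one.indicator hs) f.measurable]
      rfl
    have hN1 : (N : ℝ≥0∞) * (N : ℝ≥0∞)⁻¹ = 1 :=
      ENNReal.mul_inv_cancel (by simpa using hN) (ENNReal.natCast_ne_top N)
    rw [hfs, ← Finset.sum_coe_sort f.range]
    simp only [w, Measure.finsetSum_apply, Measure.smul_apply, Measure.dirac_apply' _ hs,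
      smul_eq_mul, Fintype.sum_prod_type, Finset.sum_const, Finset.card_univ, Fintype.card_fin,
      nsmul_eq_mul]
    refine Finset.sum_congr rfl fun x _ => ?_
    calc _ = (μ : Measure X) (f ⁻¹' {(x : X)}) * s.indicator 1 (x : X) *
        ((N : ℝ≥0∞) * (N : ℝ≥0∞)⁻¹) := by ring
      _ = _ := by rw [hN1, mul_one, mul_comm]
  have hw : ∑ i, w i = 1 := by
    have := congrArg (fun ν : Measure X => ν univ) hmeas
    simpa [Measure.map_apply f.measurable MeasurableSet.univ] using this
  refine ⟨w, hw, fun i => mul_le_of_le_one_left' prob_le_one, ?_⟩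
  exact Subtype.ext hmeas

theorem isOpen_setOf_measure_lt {X : Type*} [TopologicalSpace X] [MeasurableSpace X]
    [OpensMeasurableSpace X] [HasOuterApproxClosed X] {F : Set X} (hF : IsClosed F) (ε : ℝ≥0∞) :
    IsOpen {μ : ProbabilityMeasure X | (μ : Measure X) F < ε} :=
  isOpen_iff_mem_nhds.2 fun μ hμ => eventually_lt_of_limsup_lt
    ((limsup_measure_closed_le_of_tendsto tendsto_id hF).trans_lt hμ)

/-- If `D ⊆ X × X` is closed and nowhere dense, then `μ × μ` vanishes on `D` for comeagre many
probability measures `μ` on `X`. -/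
theorem setOf_prod_self_null_mem_residual {X : Type*} [TopologicalSpace X]
    [TopologicalSpace.PseudoMetrizableSpace X] [SecondCountableTopology X] [MeasurableSpace X]
    [BorelSpace X] {D : Set (X × X)} (hD : IsClosed D) (hD' : Dense Dᶜ) :
    {μ : ProbabilityMeasure X | (μ.prod μ : Measure (X × X)) D = 0} ∈
      residual (ProbabilityMeasure X) := by
  have key : ∀ n : ℕ, {μ : ProbabilityMeasure X |
      (μ.prod μ : Measure (X × X)) D < ((n : ℝ≥0∞) + 1)⁻¹} ∈ residual (ProbabilityMeasure X) := by
    intro n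
    refine residual_of_dense_open ?_ ?_
    · have hc : Continuous fun μ : ProbabilityMeasure X => μ.prod μ :=
        continuous_prod.comp (continuous_id.prodMk continuous_id)
      exact (isOpen_setOf_measure_lt hD _).preimage hc
    · refine dense_iff_inter_open.2 fun U hU ⟨μ, hμ⟩ => ?_
      obtain ⟨f, hf⟩ := exists_simpleFunc_map_mem hU hμ
      -- With `n + 2` copies the bound `1 / (n + 2)` is strictly below the required `1 / (n + 1)`.
      obtain ⟨w, hw, hwN, hwf⟩ := exists_discrete_eq_map μ f (N := n + 2) (by lia)
      rw [← hwf] at hf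
      obtain ⟨x, hxU, hx⟩ := (dense_setOf_pairwise_notMem (ι := f.range × Fin (n + 2)) hD
        hD').inter_open_nonempty _ (hU.preimage (continuous_discrete w hw)) ⟨_, hf⟩
      refine ⟨_, hxU, (prod_discrete_le hw hwN hD.measurableSet hx).trans_lt ?_⟩
      rw [ENNReal.inv_lt_inv]
      exact_mod_cast Nat.lt_succ_self (n + 1)
  filter_upwards [eventually_countable_forall.2 key] with μ hμ
  by_contra h0
  obtain ⟨n, hn⟩ := ENNReal.exists_inv_nat_lt h0
  exact lt_asymm hn ((hμ n).trans_le (ENNReal.inv_le_inv.2 le_self_add))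

end MeasureTheory.ProbabilityMeasure

/-! ### Haar-null sets and the main theorem -/

namespace SteinhausPolish

theorem leftNullMeasures_mem_residual {G : Type*} [Group G] [TopologicalSpace G]
    [IsTopologicalGroup G] [PolishSpace G] [MeasurableSpace G] [BorelSpace G] {A : Set G}
    (hA : IsMeagre (A⁻¹ * A)) : leftNullMeasures A ∈ residual (ProbabilityMeasure G) := by
  obtain ⟨S, hSo, hSd, hSc, hSA⟩ := mem_residual_iff.1 hA
  let φ : G × G → G := fun p => p.1⁻¹ * p.2
  have hφ : Continuous φ := by fun_prop
  have hφo : IsOpenMap φ := IsOpenMap.of_sections fun x =>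
    ⟨fun y => (x.1, x.1 * y), by fun_prop, by simp [φ], fun y => by simp [φ]⟩
  have hres : ∀ U ∈ S, ∀ᶠ μ : ProbabilityMeasure G in residual _,
      (μ.prod μ : Measure (G × G)) (φ ⁻¹' Uᶜ) = 0 := fun U hU =>
    ProbabilityMeasure.setOf_prod_self_null_mem_residual
      ((hSo U hU).isClosed_compl.preimage hφ)
      (by simpa using (hSd U hU).preimage hφo)
  filter_upwards [(eventually_countable_ball hSc).2 hres] with μ hμ g
  -- The cover does not depend on `g`, since `(g * a)⁻¹ * (g * b) = a⁻¹ * b`; hence one `μ` works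
  -- for all of the possibly uncountably many translates.
  have hsub : (g • A) ×ˢ (g • A) ⊆ ⋃ U ∈ S, φ ⁻¹' Uᶜ := by
    rintro ⟨_, _⟩ ⟨⟨a, ha, rfl⟩, ⟨b, hb, rfl⟩⟩
    have hmem : a⁻¹ * b ∈ A⁻¹ * A := Set.mul_mem_mul (Set.inv_mem_inv.2 ha) hb
    have hnot : a⁻¹ * b ∉ ⋂₀ S := fun h => hSA h hmem
    simp only [mem_sInter, not_forall] at hnot
    obtain ⟨U, hU, hUab⟩ := hnot
    refine mem_biUnion hU ?_
    simpa [φ, mul_assoc] using hUab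
  have h0 : (μ.prod μ : Measure (G × G)) ((g • A) ×ˢ (g • A)) = 0 :=
    measure_mono_null hsub ((measure_biUnion_null_iff hSc).2 hμ)
  rw [ProbabilityMeasure.toMeasure_prod, Measure.prod_prod] at h0
  exact mul_self_eq_zero.1 h0

end SteinhausPolish

theorem MeasureTheory.AnalyticSet.inv_mul_self {G : Type*} [Group G] [TopologicalSpace G]
    [IsTopologicalGroup G] {A : Set G} (hA : AnalyticSet A) : AnalyticSet (A⁻¹ * A) := by
  obtain ⟨β, _, _, f, hf, rfl⟩ := analyticSet_iff_exists_polishSpace_range.1 hA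
  have : (range f)⁻¹ * range f = range fun p : β × β => (f p.1)⁻¹ * f p.2 := by
    ext x
    constructor
    · rintro ⟨_, ⟨a, ha⟩, _, ⟨b, rfl⟩, rfl⟩
      exact ⟨(a, b), by simp [ha]⟩
    · rintro ⟨p, rfl⟩
      exact Set.mul_mem_mul (Set.inv_mem_inv.2 (mem_range_self _)) (mem_range_self _)
  rw [this]
  exact analyticSet_range_of_polishSpace (by fun_prop)

theorem mainTheorem2 {G : Type*} [Group G] [TopologicalSpace G] [IsTopologicalGroup G]
    [PolishSpace G] [Uncountable G] [MeasurableSpace G] [BorelSpace G]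
    (A : Set G) (hA : MeasureTheory.AnalyticSet A) :
    (¬ SteinhausPolish.IsGenericallyLeftHaarNull A →
      (1 : G) ∈ interior (A⁻¹ * A * A⁻¹ * A)) ∧
    (¬ SteinhausPolish.IsLeftHaarNull A →
      ¬ SteinhausPolish.IsGenericallyLeftHaarNull A ∧
        (1 : G) ∈ interior (A⁻¹ * A * A⁻¹ * A)) := by
  have hum : SteinhausPolish.UniversallyMeasurable A := fun μ => hA.nullMeasurableSet _
  have hint : ¬ SteinhausPolish.IsGenericallyLeftHaarNull A →
      (1 : G) ∈ interior (A⁻¹ * A * A⁻¹ * A) := by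
    intro h
    have hnm : ¬ IsMeagre (A⁻¹ * A) := fun hm =>
      h ⟨hum, SteinhausPolish.leftNullMeasures_mem_residual hm⟩
    simpa [mul_assoc] using hA.inv_mul_self.baireMeasurableSet.one_mem_interior_inv_mul hnm
  refine ⟨hint, fun h => ?_⟩
  have hgen : ¬ SteinhausPolish.IsGenericallyLeftHaarNull A := by
    rintro ⟨_, hres⟩
    have : Nonempty (ProbabilityMeasure G) := ⟨diracProba 1⟩
    exact h ⟨hum, (dense_of_mem_residual hres).nonempty⟩
  exact ⟨hgen, hint hgen⟩
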